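/- **Theorem.** A *Dyck path of size $n$* is a word with $n$ up-steps and $n$ down-steps, starting at height $0$, whose height stays nonnegative. The *Tamari order* on Dyck paths of size $n$ is the reflexive transitive closure of the relation in which $Q$ is larger than $P$ if $Q$ is obtained from $P$ by exchanging a down-step that is followed by an up-step with the shortest excursion that follows it. Let $\mathcal I_n$ be the set of Tamari intervals of size $n$, that is, of pairs $(P,Q)$ of Dyck paths of size $n$ with $P\le Q$; let $\mathrm{contact}(P)$ be the number of vertices of $P$ on the horizontal axis, and let $Q(i)$ be the height of $Q$ at abscissa $i$. Let $$H(t,x,s)=\sum_{n\ge 0}t^n\sum_{(P,Q)\in\mathcal I_n}x^{\mathrm{contact}(P)}\sum_{i=0}^{2n}s^{Q(i)},\qquad H(1):=H(t,1,s)\in\mathbb Q[s][[t]].$$ Then $H(1)$ has the following rational parametrization. There is a unique power series $z=z(t)\in\mathbb Q[[t]]$ with $t=z(1-z)^3$. There is a unique power series $U=U(z,s)\in\mathbb Q[s][[z]]$ with $$s\,z(1+U)^2(1-Uz^2-2z)=U(1-z)^3,\qquad\text{i.e.}\qquad s=\frac{U(1-z)^3}{z(1+U)^2(1-Uz^2-2z)}.$$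 This $U$ has no constant term in $z$, and, in $\mathbb Q[s][[z]]$, $$H\bigl(z(1-z)^3,1,s\bigr)=\frac{(1-2z-Uz^2)^2(1+U)}{(1-z)^6}.$$ -/

import Mathlib

/-- Dyck paths of size `n`, as words in up-steps `U` and down-steps `D`. -/
abbrev DyckPath (n : ℕ) : Type := {p : DyckWord // p.semilength = n}

/-- The height of the point of the path `P` at abscissa `i`. The subtraction does not truncate,
since a prefix of a Dyck word has at least as many up-steps as down-steps. -/
def dyckHeight (P : DyckWord) (i : ℕ) : ℕ :=
  (P.toList.take i).count DyckStep.U - (P.toList.take i).count DyckStep.D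

/-- The number of contacts of `P`: its vertices lying on the horizontal axis,
both endpoints included. -/
def dyckContacts (P : DyckWord) : ℕ :=
  ((Finset.range (P.toList.length + 1)).filter fun i => dyckHeight P i = 0).card

/-- The elementary Tamari move: `Q` is obtained from `P` by exchanging a down-step, which is
followed by an up-step, with the shortest excursion `E` that follows it. That `E` is the shortest
excursion means that it is a nonempty Dyck word which stays strictly above its starting level
except at its two endpoints (`DyckWord.IsNested`). -/
def TamariMove (P Q : DyckWord) : Prop :=
  ∃ (A B : List DyckStep) (E : DyckWord), E.IsNested ∧
    P.toList = A ++ [DyckStep.D] ++ E.toList ++ B ∧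
    Q.toList = A ++ E.toList ++ [DyckStep.D] ++ B

/-- The Tamari order: the reflexive transitive closure of the elementary moves. -/
def TamariLE (P Q : DyckWord) : Prop := Relation.ReflTransGen TamariMove P Q

open Classical in
/-- The Tamari intervals of size `n`: pairs `(P, Q)` of Dyck paths of size `n` with `P ≤ Q`. -/
noncomputable def tamariIntervals (n : ℕ) : Finset (DyckPath n × DyckPath n) :=
  Finset.univ.filter fun I => TamariLE I.1.1 I.2.1

/-- The generating function `H(t, x, s)` of Tamari intervals with a marked abscissa, as a power
series in `t`, at elements `x`, `s` of a commutative ring of coefficients: `t` marks the size, `x`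
the contacts of the lower path, `s` the height of the upper path at the marked abscissa. -/
noncomputable def tamariUpperSeries {R : Type*} [CommRing R] (x s : R) : PowerSeries R :=
  PowerSeries.mk fun n =>
    ∑ I ∈ tamariIntervals n,
      x ^ dyckContacts I.1.1 * ∑ i ∈ Finset.range (2 * n + 1), s ^ dyckHeight I.2.1 i

/-- The relation `s = U (1 - z)³ / (z (1 + U)² (1 - U z² - 2 z))` between power series in `z`
with coefficients in `ℚ[s]`, with the denominator cleared. -/
def IsUpperParameter (U : PowerSeries (Polynomial ℚ)) : Prop :=
  PowerSeries.C (Polynomial.X : Polynomial ℚ) *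
      (PowerSeries.X * (1 + U) ^ 2 * (1 - U * PowerSeries.X ^ 2 - 2 * PowerSeries.X)) =
    U * (1 - PowerSeries.X) ^ 3

/-!
The proof decomposes Tamari intervals along the upper path and then applies the kernel method.

Write a nonempty Dyck path as `q.nest + r`, where `q.nest` ends at the first return to the axis. On
words in this form an elementary move acts inside `q`, or inside `r`, or exchanges the last
down-step of `q.nest` with the first excursion of `r` (`TamariStep`). By induction on a chain of
moves, the paths below `q.nest + r` are exactly the paths `a.nest + b + c` with `a + b` below `q`
and `c` below `r` (`tamariLE_nest_add_iff`). Hence they arise from a path below `q` with a marked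
contact and a path below `r`. Summing `x ^ contacts` over the marked contact gives a geometric sum,
and the vertices of `q.nest + r` are the starting point, the vertices of `q` one level up, and the
vertices of `r`. With `F(x)` the generating function of the intervals by contacts, this yields
* `(x - 1) F(x) = (x - 1) x + t x (F(x) - F(1)) F(x)`,
* `(x - 1) H(x) = (x - 1) x + t x (F(x) - F(1) + s (H(x) - H(1))) F(x) + t x (F(x) - F(1)) H(x)`,
over any commutative ring of coefficients and for any `x` in it
(`tamariSeries_functionalEquation`, `tamariUpperSeries_functionalEquation`). In particular, `x` may
be a power series in `z`; the two equations are then evaluated at `t = z (1 - z)³` (`evalHom`).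

The first equation is solved by `x = (1 + u) / (1 + z u)²` and
`F(x) = (1 + u) (1 - 2 z - z² u) / ((1 + z u) (1 - z)³)`
(`functionalEquation_parametrization`). When `u` is an indeterminate, `x - 1` is `u` times a unit
and `F(1)` is the value at `u = 0`, so a `z`-adic argument shows that this is the only solution;
thus `F(1) = (1 - 2 z) / (1 - z)³` (`evalSize_tamariSeries_one`). Once `F(1)` is known, the first
equation is quadratic in `F(x)`, and for the value `u = U` the constant coefficients single out its
root. The relation that defines `U` says `x - 1 = t s F(x)²`. This makes the coefficient of `H(x)`
vanish in the second equation, which then reads `x H(1) = F(x)²`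
(`IsUpperParameter.subst_tamariUpperSeries`). The existence and the uniqueness of `z(t)` and of `U`
follow from the fixed point theorem for `X`-adic contractions.
-/

/-! ### The Tamari order and the first-return decomposition -/

section TamariOrder

open DyckStep

namespace DyckWord

/-- Induction along the decomposition of a nonempty Dyck word at its first return to the axis. -/
theorem nest_add_induction {C : DyckWord → Prop} (zero : C 0)
    (nest_add : ∀ a b, C a → C b → C (a.nest + b)) (p : DyckWord) : C p := by
  by_cases h : p = 0
  · exact h ▸ zero
  · have h₁ := semilength_insidePart_lt h
    have h₂ := semilength_outsidePart_lt h
    rw [← nest_insidePart_add_outsidePart h]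
    exact nest_add _ _ (nest_add_induction zero nest_add _) (nest_add_induction zero nest_add _)
termination_by p.semilength

theorem nest_add_inj {a b a' b' : DyckWord} :
    a.nest + b = a'.nest + b' ↔ a = a' ∧ b = b' := by
  constructor
  · intro h
    have h₁ := congrArg insidePart h
    have h₂ := congrArg outsidePart h
    rw [insidePart_add nest_ne_zero, insidePart_add nest_ne_zero, insidePart_nest,
      insidePart_nest] at h₁
    rw [outsidePart_add nest_ne_zero, outsidePart_add nest_ne_zero, outsidePart_nest,
      outsidePart_nest, zero_add, zero_add] at h₂
    exact ⟨h₁, h₂⟩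
  · rintro ⟨rfl, rfl⟩
    rfl

theorem nest_add_ne_zero {a b : DyckWord} : a.nest + b ≠ 0 := by
  intro h
  have := congrArg semilength h
  simp at this

theorem toList_add (p q : DyckWord) : (p + q).toList = p.toList ++ q.toList := rfl

theorem toList_nest (p : DyckWord) : p.nest.toList = U :: (p.toList ++ [D]) := rfl

/-- A suffix of a Dyck word that follows a Dyck word is a Dyck word. -/
theorem exists_eq_of_toList_eq_append {p q : DyckWord} {l : List DyckStep}
    (h : p.toList = q.toList ++ l) : ∃ r : DyckWord, r.toList = l := by
  refine ⟨⟨l, ?_, fun i => ?_⟩, rfl⟩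
  · have h₁ := p.count_U_eq_count_D
    have h₂ := q.count_U_eq_count_D
    rw [h, List.count_append, List.count_append] at h₁
    omega
  · have h₁ := p.count_D_le_count_U (q.toList.length + i)
    have h₂ := q.count_U_eq_count_D
    rw [h, List.take_length_add_append, List.count_append, List.count_append] at h₁
    omega

end DyckWord

open DyckWord

/-- The elementary Tamari move, by recursion along the first-return decomposition: it acts inside
the first excursion, or after it, or exchanges the final down-step of the first excursion with the
second excursion. -/
inductive TamariStep : DyckWord → DyckWord → Prop
  | inside {a a' : DyckWord} (h : TamariStep a a') (b : DyckWord) :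
      TamariStep (a.nest + b) (a'.nest + b)
  | outside (a : DyckWord) {b b' : DyckWord} (h : TamariStep b b') :
      TamariStep (a.nest + b) (a.nest + b')
  | exchange (a e b : DyckWord) : TamariStep (a.nest + (e.nest + b)) ((a + e.nest).nest + b)

theorem TamariStep.tamariMove {P Q : DyckWord} (h : TamariStep P Q) : TamariMove P Q := by
  induction h with
  | inside h b ih =>
    obtain ⟨A, B, E, hE, h₁, h₂⟩ := ih
    exact ⟨U :: A, B ++ D :: b.toList, E, hE, by simp [toList_add, toList_nest, h₁],
      by simp [toList_add, toList_nest, h₂]⟩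
  | outside a h ih =>
    obtain ⟨A, B, E, hE, h₁, h₂⟩ := ih
    exact ⟨a.nest.toList ++ A, B, E, hE, by simp [toList_add, h₁], by simp [toList_add, h₂]⟩
  | exchange a e b =>
    exact ⟨U :: a.toList, b.toList, e.nest, .nest, by simp [toList_add, toList_nest],
      by simp [toList_add, toList_nest]⟩

/-- An excursion that follows a down-step inside a Dyck word `a` ends inside `a`, since the part
of `a` that comes after this down-step ends strictly below the level where it starts. -/
theorem exists_eq_append_of_append_cons_eq {a E : DyckWord} {A a'' B l : List DyckStep}
    (ha : a.toList = A ++ D :: a'') (h : a'' ++ D :: l = E.toList ++ B) :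
    ∃ c, a'' = E.toList ++ c ∧ B = c ++ D :: l := by
  rcases List.append_eq_append_iff.1 h with ⟨c, hE, hc⟩ | ⟨c, h₁, h₂⟩
  · rcases c with _ | ⟨d, c⟩
    · exact ⟨[], by simpa using hE.symm, by simpa using hc.symm⟩
    · exfalso
      simp only [List.cons_append, List.cons.injEq] at hc
      have h₁ := E.count_D_le_count_U (a''.length + 1)
      rw [hE, List.take_length_add_append, ← hc.1] at h₁
      have h₂ := a.count_D_le_count_U (A.length + 1)
      have h₃ := a.count_U_eq_count_D
      rw [ha, List.take_length_add_append] at h₂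
      rw [ha] at h₃
      simp [List.count_append] at h₁ h₂ h₃
      omega
  · exact ⟨c, h₁, h₂⟩

theorem exists_nest_eq_of_isNested {E : DyckWord} (hE : E.IsNested) : ∃ e : DyckWord, E = e.nest :=
  ⟨E.denest hE, (E.nest_denest hE).symm⟩

/-- A move applied to the list of steps of a Dyck word yields a Dyck word, and is a `TamariStep`. -/
theorem exists_tamariStep_of_toList_eq (P : DyckWord) {A B : List DyckStep} {E : DyckWord}
    (hE : E.IsNested) (hP : P.toList = A ++ D :: (E.toList ++ B)) :
    ∃ Q : DyckWord, Q.toList = A ++ (E.toList ++ D :: B) ∧ TamariStep P Q := by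
  induction P using nest_add_induction generalizing A B with
  | zero =>
    have := congrArg List.length hP
    simp [show (0 : DyckWord).toList = [] from rfl] at this
  | nest_add a b iha ihb =>
    rcases A with _ | ⟨d, A⟩
    · simp [toList_add, toList_nest] at hP
    simp only [toList_add, toList_nest, List.cons_append, List.append_assoc, List.nil_append,
      List.cons.injEq] at hP
    obtain ⟨rfl, hP⟩ := hP
    rcases List.append_eq_append_iff.1 hP with ⟨c, hA, hc⟩ | ⟨c, ha, hc⟩
    · rcases c with _ | ⟨d, c⟩
      · -- the down-step is the last step of the first excursion
        simp only [List.append_nil, List.nil_append, List.cons.injEq, true_and] at hA hc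
        obtain ⟨e, rfl⟩ := exists_nest_eq_of_isNested hE
        obtain ⟨r, rfl⟩ := exists_eq_of_toList_eq_append hc
        obtain rfl : b = e.nest + r := DyckWord.ext hc
        exact ⟨_, by simp [toList_add, toList_nest, hA], .exchange a e r⟩
      · -- the down-step comes after the first excursion
        simp only [List.cons_append, List.cons.injEq] at hc
        obtain ⟨rfl, hc⟩ := hc
        obtain ⟨Q, hQ, h⟩ := ihb hc
        exact ⟨a.nest + Q, by simp [toList_add, toList_nest, hQ, hA], .outside a h⟩
    · rcases c with _ | ⟨d, c⟩
      · simp only [List.append_nil, List.nil_append, List.cons.injEq, true_and] at ha hc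
        obtain ⟨e, rfl⟩ := exists_nest_eq_of_isNested hE
        obtain ⟨r, rfl⟩ := exists_eq_of_toList_eq_append hc.symm
        obtain rfl : b = e.nest + r := DyckWord.ext hc.symm
        exact ⟨_, by simp [toList_add, toList_nest, ha], .exchange a e r⟩
      · -- the down-step, and then also `E`, lies inside the first excursion
        simp only [List.cons_append, List.cons.injEq] at hc
        obtain ⟨rfl, hc⟩ := hc
        obtain ⟨c', rfl, rfl⟩ := exists_eq_append_of_append_cons_eq ha hc.symm
        obtain ⟨Q, hQ, h⟩ := iha ha
        exact ⟨Q.nest + b, by simp [toList_add, toList_nest, hQ], .inside h b⟩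

theorem tamariMove_iff_tamariStep {P Q : DyckWord} : TamariMove P Q ↔ TamariStep P Q := by
  refine ⟨?_, TamariStep.tamariMove⟩
  rintro ⟨A, B, E, hE, hP, hQ⟩
  obtain ⟨Q', hQ', h⟩ := exists_tamariStep_of_toList_eq P (A := A) (B := B) hE (by simpa using hP)
  obtain rfl : Q' = Q := DyckWord.ext (by rw [hQ', hQ]; simp)
  exact h

theorem tamariLE_iff {P Q : DyckWord} : TamariLE P Q ↔ Relation.ReflTransGen TamariStep P Q := by
  have : TamariMove = TamariStep := by
    ext P Q
    exact tamariMove_iff_tamariStep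
  rw [TamariLE, this]

namespace TamariStep

theorem semilength_eq {P Q : DyckWord} (h : TamariStep P Q) : P.semilength = Q.semilength := by
  induction h with
  | inside h b ih => simp [ih]
  | outside a h ih => simp [ih]
  | exchange a e b => simp; omega

theorem add_right {P Q : DyckWord} (h : TamariStep P Q) (c : DyckWord) :
    TamariStep (P + c) (Q + c) := by
  induction h with
  | inside h b ih => simpa [add_assoc] using inside h (b + c)
  | outside a h ih => simpa [add_assoc] using outside a ih
  | exchange a e b => simpa [add_assoc] using exchange a e (b + c)

theorem add_left (c : DyckWord) {P Q : DyckWord} (h : TamariStep P Q) :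
    TamariStep (c + P) (c + Q) := by
  induction c using nest_add_induction with
  | zero => simpa using h
  | nest_add a b _ ih => simpa [add_assoc] using outside a ih

theorem eq_nest_add {P q r : DyckWord} (h : TamariStep P (q.nest + r)) :
    (∃ a, TamariStep a q ∧ P = a.nest + r) ∨ (∃ b, TamariStep b r ∧ P = q.nest + b) ∨
      ∃ a e : DyckWord, q = a + e.nest ∧ P = a.nest + (e.nest + r) := by
  generalize hQ : q.nest + r = Q at h
  cases h with
  | inside h b =>
    obtain ⟨rfl, rfl⟩ := nest_add_inj.1 hQ
    exact .inl ⟨_, h, rfl⟩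
  | outside a h =>
    obtain ⟨rfl, rfl⟩ := nest_add_inj.1 hQ
    exact .inr (.inl ⟨_, h, rfl⟩)
  | exchange a e b =>
    obtain ⟨rfl, rfl⟩ := nest_add_inj.1 hQ
    exact .inr (.inr ⟨_, _, rfl, rfl⟩)

theorem eq_add {P q r : DyckWord} (h : TamariStep P (q + r)) :
    (∃ a, TamariStep a q ∧ P = a + r) ∨ ∃ b, TamariStep b r ∧ P = q + b := by
  induction q using nest_add_induction generalizing P with
  | zero => exact .inr ⟨P, by simpa using h, by simp⟩
  | nest_add n m _ ih =>
    rw [add_assoc] at h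
    rcases h.eq_nest_add with ⟨a, ha, rfl⟩ | ⟨b, hb, rfl⟩ | ⟨a, e, rfl, rfl⟩
    · exact .inl ⟨_, inside ha m, (add_assoc _ _ _).symm⟩
    · rcases ih hb with ⟨a, ha, rfl⟩ | ⟨c, hc, rfl⟩
      · exact .inl ⟨_, outside n ha, (add_assoc _ _ _).symm⟩
      · exact .inr ⟨_, hc, (add_assoc _ _ _).symm⟩
    · exact .inl ⟨_, exchange a e m, by simp [add_assoc]⟩

end TamariStep

namespace TamariLE

theorem refl (P : DyckWord) : TamariLE P P := Relation.ReflTransGen.refl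

theorem trans {P Q R : DyckWord} (h₁ : TamariLE P Q) (h₂ : TamariLE Q R) : TamariLE P R :=
  Relation.ReflTransGen.trans h₁ h₂

theorem of_step {P Q : DyckWord} (h : TamariStep P Q) : TamariLE P Q :=
  .single (tamariMove_iff_tamariStep.2 h)

theorem map {f : DyckWord → DyckWord} (hf : ∀ P Q, TamariStep P Q → TamariStep (f P) (f Q))
    {P Q : DyckWord} (h : TamariLE P Q) : TamariLE (f P) (f Q) :=
  tamariLE_iff.2 ((tamariLE_iff.1 h).lift f hf)

theorem semilength_eq {P Q : DyckWord} (h : TamariLE P Q) : P.semilength = Q.semilength := by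
  rw [tamariLE_iff] at h
  induction h with
  | refl => rfl
  | tail _ h ih => exact ih.trans h.semilength_eq

theorem eq_zero {P : DyckWord} (h : TamariLE P 0) : P = 0 := by
  by_contra hP
  have h₁ := h.semilength_eq
  rw [← nest_insidePart_add_outsidePart hP] at h₁
  simp at h₁

/-- The last down-step of an excursion can be moved past any number of excursions. -/
theorem nest_add_le (a b : DyckWord) : TamariLE (a.nest + b) (a + b).nest := by
  induction b using nest_add_induction generalizing a with
  | zero => simpa using refl _
  | nest_add e m _ ih => simpa [add_assoc] using (of_step (.exchange a e m)).trans (ih (a + e.nest))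

end TamariLE

/-- The lower set of a Dyck path in the Tamari order: forgetting the first up-step of the lower
path and the down-step of its first return gives a path `a + b` below `q`, of which one contact is
marked. -/
theorem tamariLE_nest_add_iff {P q r : DyckWord} :
    TamariLE P (q.nest + r) ↔
      ∃ a b c, P = a.nest + b + c ∧ TamariLE (a + b) q ∧ TamariLE c r := by
  constructor
  · intro h
    rw [tamariLE_iff] at h
    induction h using Relation.ReflTransGen.head_induction_on with
    | refl => exact ⟨q, 0, r, by simp, by simpa using TamariLE.refl q, .refl r⟩
    | head hstep _ ih =>
      obtain ⟨a, b, c, rfl, hab, hc⟩ := ih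
      rw [add_assoc] at hstep
      rcases hstep.eq_nest_add with ⟨a', h, rfl⟩ | ⟨d, h, rfl⟩ | ⟨a', e, rfl, rfl⟩
      · exact ⟨a', b, c, (add_assoc _ _ _).symm, (TamariLE.of_step (h.add_right b)).trans hab, hc⟩
      · rcases h.eq_add with ⟨b', hb, rfl⟩ | ⟨c', hc', rfl⟩
        · exact ⟨a, b', c, (add_assoc _ _ _).symm,
            (TamariLE.of_step (hb.add_left a)).trans hab, hc⟩
        · exact ⟨a, b, c', (add_assoc _ _ _).symm, hab, (TamariLE.of_step hc').trans hc⟩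
      · exact ⟨a', e.nest + b, c, by simp [add_assoc], by simpa [add_assoc] using hab, hc⟩
  · rintro ⟨a, b, c, rfl, hab, hc⟩
    have h₁ : TamariLE (a.nest + b + c) ((a + b).nest + c) :=
      (TamariLE.nest_add_le a b).map (f := (· + c)) fun _ _ h => h.add_right c
    have h₂ : TamariLE ((a + b).nest + c) (q.nest + c) :=
      hab.map (f := fun p => p.nest + c) fun _ _ h => .inside h c
    have h₃ : TamariLE (q.nest + c) (q.nest + r) :=
      hc.map (f := fun p => q.nest + p) fun _ _ h => .outside q h
    exact h₁.trans (h₂.trans h₃)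

end TamariOrder

section Enumeration

open DyckStep DyckWord

/-! ### Heights and contacts -/

theorem dyckHeight_nest_add_succ {a b : DyckWord} {i : ℕ} (hi : i ≤ a.toList.length) :
    dyckHeight (a.nest + b) (i + 1) = dyckHeight a i + 1 := by
  have h := a.count_D_le_count_U i
  simp only [dyckHeight, toList_add, toList_nest, List.cons_append, List.append_assoc,
    List.take_succ_cons, List.take_append_of_le_length hi, List.count_cons]
  simp
  omega

theorem dyckHeight_nest_add_add {a b : DyckWord} (i : ℕ) :
    dyckHeight (a.nest + b) (a.toList.length + 2 + i) = dyckHeight b i := by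
  have hl : a.toList.length + 2 = a.nest.toList.length := by simp [toList_nest]
  have h := a.nest.count_U_eq_count_D
  rw [dyckHeight, dyckHeight, toList_add, hl, List.take_length_add_append, List.count_append,
    List.count_append, h, Nat.add_sub_add_left]

theorem dyckHeight_zero (P : DyckWord) : dyckHeight P 0 = 0 := by simp [dyckHeight]

/-- The vertices of `a.nest + b` are its starting point, the vertices of `a` one level up, and the
vertices of `b`. -/
theorem sum_dyckHeight_nest_add {M : Type*} [AddCommMonoid M] (g : ℕ → M) (a b : DyckWord) :
    ∑ i ∈ Finset.range ((a.nest + b).toList.length + 1), g (dyckHeight (a.nest + b) i) =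
      g 0 + ∑ i ∈ Finset.range (a.toList.length + 1), g (dyckHeight a i + 1) +
        ∑ i ∈ Finset.range (b.toList.length + 1), g (dyckHeight b i) := by
  have hl : (a.nest + b).toList.length + 1 = (a.toList.length + 2) + (b.toList.length + 1) := by
    simp [toList_add, toList_nest]; omega
  rw [hl, Finset.sum_range_add, show a.toList.length + 2 = (a.toList.length + 1) + 1 from rfl,
    Finset.sum_range_succ', dyckHeight_zero, add_comm (g 0)]
  congr 1
  · congr 1
    refine Finset.sum_congr rfl fun i hi => ?_
    rw [dyckHeight_nest_add_succ (Nat.lt_succ_iff.1 (Finset.mem_range.1 hi))]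
  · exact Finset.sum_congr rfl fun i _ => by rw [← dyckHeight_nest_add_add (a := a) i]

theorem dyckContacts_eq_sum (P : DyckWord) :
    dyckContacts P =
      ∑ i ∈ Finset.range (P.toList.length + 1), if dyckHeight P i = 0 then 1 else 0 :=
  Finset.card_filter _ _

theorem dyckContacts_zero : dyckContacts 0 = 1 := by
  rw [dyckContacts_eq_sum]
  exact (Finset.sum_range_one _).trans (if_pos (dyckHeight_zero 0))

theorem dyckContacts_nest_add (a b : DyckWord) :
    dyckContacts (a.nest + b) = dyckContacts b + 1 := by
  rw [dyckContacts_eq_sum, sum_dyckHeight_nest_add fun h => if h = 0 then 1 else 0,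
    dyckContacts_eq_sum b]
  simp [add_comm]

theorem dyckContacts_add (a b : DyckWord) :
    dyckContacts (a + b) + 1 = dyckContacts a + dyckContacts b := by
  induction a using nest_add_induction with
  | zero => simp [dyckContacts_zero, add_comm]
  | nest_add n m _ ih =>
    rw [add_assoc, dyckContacts_nest_add, dyckContacts_nest_add]
    omega

theorem dyckContacts_nest_add_add (a b c : DyckWord) :
    dyckContacts (a.nest + b + c) = dyckContacts b + dyckContacts c := by
  rw [add_assoc, dyckContacts_nest_add, dyckContacts_add]

/-! ### Factorizations of a Dyck word -/

/-- A factorization of `a.nest + b` has an empty first factor or a first factor that starts with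
`a.nest`. -/
theorem add_eq_nest_add_iff {l r a b : DyckWord} :
    l + r = a.nest + b ↔ (l = 0 ∧ r = a.nest + b) ∨ ∃ m, m + r = b ∧ l = a.nest + m := by
  constructor
  · intro h
    induction l using nest_add_induction with
    | zero => exact .inl ⟨rfl, by simpa using h⟩
    | nest_add n m _ _ =>
      rw [add_assoc] at h
      obtain ⟨rfl, hm⟩ := nest_add_inj.1 h
      exact .inr ⟨m, hm, rfl⟩
  · rintro (⟨rfl, rfl⟩ | ⟨m, rfl, rfl⟩)
    · simp
    · rw [add_assoc]

theorem finite_setOf_add_eq (p : DyckWord) : {x : DyckWord × DyckWord | x.1 + x.2 = p}.Finite := by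
  induction p using nest_add_induction with
  | zero =>
    refine (Set.finite_singleton (0, 0)).subset ?_
    rintro ⟨l, r⟩ h
    simpa using h
  | nest_add a b _ ih =>
    refine ((Set.finite_singleton (0, a.nest + b)).union
      (ih.image fun x => (a.nest + x.1, x.2))).subset ?_
    rintro ⟨l, r⟩ h
    rcases add_eq_nest_add_iff.1 h with ⟨rfl, rfl⟩ | ⟨m, h, rfl⟩
    · exact .inl rfl
    · exact .inr ⟨(m, r), h, rfl⟩

/-- The factorizations of a Dyck word as a sum of two Dyck words; they correspond to the
contacts of the path. -/
noncomputable def splittings (p : DyckWord) : Finset (DyckWord × DyckWord) :=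
  (finite_setOf_add_eq p).toFinset

theorem mem_splittings {p : DyckWord} {x : DyckWord × DyckWord} :
    x ∈ splittings p ↔ x.1 + x.2 = p := by
  simp [splittings]

theorem splittings_zero : splittings 0 = {(0, 0)} := by
  ext ⟨l, r⟩
  simp [mem_splittings]

theorem splittings_nest_add (a b : DyckWord) :
    splittings (a.nest + b) =
      insert (0, a.nest + b) ((splittings b).image fun x => (a.nest + x.1, x.2)) := by
  ext ⟨l, r⟩
  simp only [mem_splittings, add_eq_nest_add_iff, Finset.mem_insert, Finset.mem_image,
    Prod.mk.injEq, Prod.exists]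
  refine or_congr_right ⟨?_, ?_⟩
  · rintro ⟨m, h, rfl⟩
    exact ⟨m, r, h, rfl, rfl⟩
  · rintro ⟨m, r, h, rfl, rfl⟩
    exact ⟨m, h, rfl⟩

/-- The tails of a path with `k` contacts have `1, …, k` contacts, so that the sum is geometric. -/
theorem sub_one_mul_sum_splittings {R : Type*} [CommRing R] (x : R) (p : DyckWord) :
    (x - 1) * ∑ y ∈ splittings p, x ^ dyckContacts y.2 = x * (x ^ dyckContacts p - 1) := by
  induction p using nest_add_induction with
  | zero => simp [splittings_zero, dyckContacts_zero, mul_comm]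
  | nest_add a b _ ih =>
    rw [splittings_nest_add, Finset.sum_insert, Finset.sum_image, mul_add, ih,
      dyckContacts_nest_add]
    · ring
    · rintro ⟨l, r⟩ _ ⟨l', r'⟩ _ h
      simpa using h
    · simp only [Finset.mem_image, Prod.mk.injEq, not_exists, not_and]
      rintro ⟨l, r⟩ _ h
      exact absurd h nest_add_ne_zero

/-! ### Sums over Dyck words and over lower sets -/

/-- The Dyck words of semilength `n`. -/
def dyckWords (n : ℕ) : Finset DyckWord :=
  (Finset.univ : Finset (DyckPath n)).map (Function.Embedding.subtype _)

theorem mem_dyckWords {n : ℕ} {p : DyckWord} : p ∈ dyckWords n ↔ p.semilength = n := by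
  simp [dyckWords]

theorem dyckWords_zero : dyckWords 0 = {0} := by
  ext p
  rw [mem_dyckWords, Finset.mem_singleton]
  refine ⟨fun h => ?_, fun h => h ▸ rfl⟩
  by_contra hp
  rw [← nest_insidePart_add_outsidePart hp] at h
  simp at h

theorem sum_dyckWords_succ {M : Type*} [AddCommMonoid M] (f : DyckWord → M) (n : ℕ) :
    ∑ p ∈ dyckWords (n + 1), f p =
      ∑ k ∈ Finset.HasAntidiagonal.antidiagonal n,
        ∑ q ∈ dyckWords k.1, ∑ r ∈ dyckWords k.2, f (q.nest + r) := by
  simp_rw [← Finset.sum_product']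
  rw [Finset.sum_sigma']
  refine Finset.sum_bij' (fun p _ => ⟨(p.insidePart.semilength, p.outsidePart.semilength),
    (p.insidePart, p.outsidePart)⟩) (fun x _ => x.2.1.nest + x.2.2) ?_ ?_ ?_ ?_ ?_
  · intro p hp
    rw [mem_dyckWords] at hp
    have h := semilength_insidePart_add_semilength_outsidePart_add_one (p := p)
      (by rintro rfl; simp at hp)
    simp only [Finset.mem_sigma, Finset.HasAntidiagonal.mem_antidiagonal,
      Finset.mem_product, mem_dyckWords,
      and_self, and_true]
    omega
  · rintro ⟨⟨i, j⟩, ⟨q, r⟩⟩ h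
    simp only [Finset.mem_sigma, Finset.HasAntidiagonal.mem_antidiagonal,
      Finset.mem_product, mem_dyckWords] at h
    simp only [mem_dyckWords, semilength_add, semilength_nest]
    omega
  · intro p hp
    rw [mem_dyckWords] at hp
    exact nest_insidePart_add_outsidePart (by rintro rfl; simp at hp)
  · rintro ⟨⟨i, j⟩, ⟨q, r⟩⟩ h
    simp only [Finset.mem_sigma, Finset.HasAntidiagonal.mem_antidiagonal,
      Finset.mem_product, mem_dyckWords] at h
    obtain ⟨-, rfl, rfl⟩ := h
    simp
  · intro p hp
    rw [mem_dyckWords] at hp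
    rw [nest_insidePart_add_outsidePart (by rintro rfl; simp at hp)]

open Classical in
/-- The Dyck words below `Q` in the Tamari order. -/
noncomputable def tamariLower (Q : DyckWord) : Finset DyckWord :=
  (dyckWords Q.semilength).filter fun P => TamariLE P Q

theorem mem_tamariLower {P Q : DyckWord} : P ∈ tamariLower Q ↔ TamariLE P Q := by
  simp only [tamariLower, Finset.mem_filter, mem_dyckWords, and_iff_right_iff_imp]
  exact TamariLE.semilength_eq

theorem tamariLower_zero : tamariLower 0 = {0} := by
  ext P
  rw [mem_tamariLower, Finset.mem_singleton]
  exact ⟨TamariLE.eq_zero, fun h => h ▸ .refl 0⟩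

theorem add_inj_of_semilength_eq {a b c d : DyckWord} (h : a + b = c + d)
    (hs : b.semilength = d.semilength) : a = c ∧ b = d := by
  have hl : b.toList.length = d.toList.length := by
    rw [← two_mul_semilength_eq_length, ← two_mul_semilength_eq_length, hs]
  obtain ⟨h₁, h₂⟩ := List.append_inj' (congrArg toList h) hl
  exact ⟨DyckWord.ext h₁, DyckWord.ext h₂⟩

theorem sum_tamariLower_nest_add {M : Type*} [AddCommMonoid M] (f : DyckWord → M)
    (q r : DyckWord) :
    ∑ P ∈ tamariLower (q.nest + r), f P =
      ∑ p ∈ tamariLower q, ∑ y ∈ splittings p, ∑ c ∈ tamariLower r, f (y.1.nest + y.2 + c) := by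
  simp_rw [← Finset.sum_product']
  rw [Finset.sum_sigma']
  symm
  refine Finset.sum_bij (fun x _ => x.2.1.1.nest + x.2.1.2 + x.2.2) ?_ ?_ ?_ ?_
  · rintro ⟨p, ⟨⟨a, b⟩, c⟩⟩ h
    simp only [Finset.mem_sigma, Finset.mem_product, mem_tamariLower, mem_splittings] at h ⊢
    obtain ⟨h, rfl, hc⟩ := h
    exact tamariLE_nest_add_iff.2 ⟨a, b, c, rfl, h, hc⟩
  · rintro ⟨p, ⟨⟨a, b⟩, c⟩⟩ h ⟨p', ⟨⟨a', b'⟩, c'⟩⟩ h' heq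
    simp only [Finset.mem_sigma, Finset.mem_product, mem_tamariLower, mem_splittings] at h h' heq
    obtain ⟨-, rfl, hc⟩ := h
    obtain ⟨-, rfl, hc'⟩ := h'
    rw [add_assoc, add_assoc] at heq
    obtain ⟨rfl, heq'⟩ := nest_add_inj.1 heq
    obtain ⟨rfl, rfl⟩ :=
      add_inj_of_semilength_eq heq' (hc.semilength_eq.trans hc'.semilength_eq.symm)
    rfl
  · intro P hP
    obtain ⟨a, b, c, rfl, hab, hc⟩ := tamariLE_nest_add_iff.1 (mem_tamariLower.1 hP)
    exact ⟨⟨a + b, ((a, b), c)⟩, by simp [mem_tamariLower, mem_splittings, hab, hc], rfl⟩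
  · intros
    rfl

/-! ### Functional equations of the generating functions -/

section Weights

variable {R : Type*} [CommRing R]

/-- The contact polynomial of the lower set of `Q`, at `x`. -/
noncomputable def lowerContacts (x : R) (Q : DyckWord) : R :=
  ∑ P ∈ tamariLower Q, x ^ dyckContacts P

theorem lowerContacts_zero (x : R) : lowerContacts x 0 = x := by
  simp [lowerContacts, tamariLower_zero, dyckContacts_zero]

theorem sub_one_mul_lowerContacts_nest_add (x : R) (q r : DyckWord) :
    (x - 1) * lowerContacts x (q.nest + r) =
      x * (lowerContacts x q - lowerContacts 1 q) * lowerContacts x r := by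
  have h : lowerContacts x (q.nest + r) =
      (∑ p ∈ tamariLower q, ∑ y ∈ splittings p, x ^ dyckContacts y.2) * lowerContacts x r := by
    simp only [lowerContacts, sum_tamariLower_nest_add, dyckContacts_nest_add_add, pow_add,
      ← Finset.mul_sum, ← Finset.sum_mul]
  rw [h, ← mul_assoc, Finset.mul_sum, Finset.sum_congr rfl fun p _ =>
    sub_one_mul_sum_splittings x p, ← Finset.mul_sum, Finset.sum_sub_distrib]
  simp only [lowerContacts, one_pow]

/-- The height polynomial of `Q`, at `s`. -/
def heightSum (s : R) (Q : DyckWord) : R :=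
  ∑ i ∈ Finset.range (Q.toList.length + 1), s ^ dyckHeight Q i

theorem heightSum_zero (s : R) : heightSum s 0 = 1 := by
  simp [heightSum, show (0 : DyckWord).toList = [] from rfl, dyckHeight_zero]

theorem heightSum_nest_add (s : R) (q r : DyckWord) :
    heightSum s (q.nest + r) = 1 + s * heightSum s q + heightSum s r := by
  rw [heightSum, sum_dyckHeight_nest_add (fun h => s ^ h)]
  simp only [heightSum, pow_zero, pow_succ, ← Finset.sum_mul, mul_comm s]

/-- The generating function of Dyck words by semilength, with weights `w`. -/
def dyckSeries (w : DyckWord → R) : PowerSeries R :=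
  PowerSeries.mk fun n => ∑ p ∈ dyckWords n, w p

theorem dyckSeries_eq {w u v u' v' : DyckWord → R}
    (h : ∀ q r, w (q.nest + r) = u q * v r + u' q * v' r) :
    dyckSeries w = PowerSeries.C (w 0) +
      PowerSeries.X * (dyckSeries u * dyckSeries v + dyckSeries u' * dyckSeries v') := by
  ext n
  rcases n with _ | n
  · simp [dyckSeries, dyckWords_zero]
  · rw [map_add, PowerSeries.coeff_succ_X_mul, map_add, PowerSeries.coeff_mul,
      PowerSeries.coeff_mul, PowerSeries.coeff_C, if_neg n.succ_ne_zero, zero_add]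
    simp only [dyckSeries, PowerSeries.coeff_mk]
    rw [sum_dyckWords_succ, ← Finset.sum_add_distrib]
    refine Finset.sum_congr rfl fun k _ => ?_
    simp only [h, Finset.sum_add_distrib, Finset.sum_mul_sum]

/-- The generating function `F(t, x)` of Tamari intervals by size and contacts of the lower path. -/
noncomputable def tamariSeries (x : R) : PowerSeries R := dyckSeries (lowerContacts x)

theorem tamariUpperSeries_eq (x s : R) :
    tamariUpperSeries x s = dyckSeries fun Q => lowerContacts x Q * heightSum s Q := by
  classical
  ext n
  simp only [tamariUpperSeries, dyckSeries, PowerSeries.coeff_mk, tamariIntervals, dyckWords,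
    Finset.sum_map, lowerContacts, tamariLower, Finset.sum_filter, Finset.sum_mul,
    Function.Embedding.subtype_apply]
  rw [← Finset.univ_product_univ, Finset.sum_product_right]
  refine Finset.sum_congr rfl fun Q _ => ?_
  obtain ⟨Q, rfl⟩ := Q
  refine Finset.sum_congr rfl fun P _ => ?_
  rw [heightSum, ← two_mul_semilength_eq_length]
  by_cases h : TamariLE P.1 Q <;> simp [h]

theorem dyckSeries_sub (u v : DyckWord → R) :
    dyckSeries (fun p => u p - v p) = dyckSeries u - dyckSeries v := by
  ext n
  simp [dyckSeries]

theorem dyckSeries_add (u v : DyckWord → R) :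
    dyckSeries (fun p => u p + v p) = dyckSeries u + dyckSeries v := by
  ext n
  simp [dyckSeries, Finset.sum_add_distrib]

theorem dyckSeries_const_mul (c : R) (u : DyckWord → R) :
    dyckSeries (fun p => c * u p) = PowerSeries.C c * dyckSeries u := by
  ext n
  simp [dyckSeries, Finset.mul_sum]

theorem dyckSeries_const_zero : dyckSeries (fun _ => (0 : R)) = 0 := by
  ext n
  simp [dyckSeries]

/-- The functional equation for Tamari intervals, with catalytic variable `x`. -/
theorem tamariSeries_functionalEquation (x : R) :
    PowerSeries.C (x - 1) * tamariSeries x = PowerSeries.C ((x - 1) * x) +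
      PowerSeries.X * (PowerSeries.C x * (tamariSeries x - tamariSeries 1) * tamariSeries x) := by
  have h := dyckSeries_eq (w := fun Q => (x - 1) * lowerContacts x Q)
    (u := fun q => x * (lowerContacts x q - lowerContacts 1 q)) (v := lowerContacts x)
    (u' := fun _ => 0) (v' := fun _ => 0)
    (fun q r => by rw [sub_one_mul_lowerContacts_nest_add]; ring)
  simp only [dyckSeries_const_mul, dyckSeries_sub, lowerContacts_zero, dyckSeries_const_zero,
    zero_mul, add_zero] at h
  exact h

/-- The functional equation for Tamari intervals with a marked vertex of the upper path, which is
the starting point, or lies in the first excursion, or comes after it. -/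
theorem tamariUpperSeries_functionalEquation (x s : R) :
    PowerSeries.C (x - 1) * tamariUpperSeries x s = PowerSeries.C ((x - 1) * x) +
      PowerSeries.X * (PowerSeries.C x * ((tamariSeries x - tamariSeries 1) +
          PowerSeries.C s * (tamariUpperSeries x s - tamariUpperSeries 1 s)) * tamariSeries x +
        PowerSeries.C x * (tamariSeries x - tamariSeries 1) * tamariUpperSeries x s) := by
  have h := dyckSeries_eq (w := fun Q => (x - 1) * (lowerContacts x Q * heightSum s Q))
    (u := fun q => x * ((lowerContacts x q - lowerContacts 1 q) +
      s * (lowerContacts x q * heightSum s q - lowerContacts 1 q * heightSum s q)))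
    (v := lowerContacts x)
    (u' := fun q => x * (lowerContacts x q - lowerContacts 1 q))
    (v' := fun r => lowerContacts x r * heightSum s r)
    (fun q r => by
      rw [← mul_assoc, sub_one_mul_lowerContacts_nest_add, heightSum_nest_add]; ring)
  simp only [dyckSeries_const_mul, dyckSeries_sub, dyckSeries_add, lowerContacts_zero,
    heightSum_zero, mul_one, ← tamariUpperSeries_eq] at h
  exact h

variable {S : Type*} [CommRing S]

theorem map_tamariSeries (φ : R →+* S) (x : R) :
    PowerSeries.map φ (tamariSeries x) = tamariSeries (φ x) := by
  ext n
  simp [tamariSeries, dyckSeries, lowerContacts]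

theorem map_tamariUpperSeries (φ : R →+* S) (x s : R) :
    PowerSeries.map φ (tamariUpperSeries x s) = tamariUpperSeries (φ x) (φ s) := by
  ext n
  simp [tamariUpperSeries]

theorem constantCoeff_tamariSeries (x : R) : PowerSeries.constantCoeff (tamariSeries x) = x := by
  simp [← PowerSeries.coeff_zero_eq_constantCoeff_apply, tamariSeries, dyckSeries, dyckWords_zero,
    lowerContacts_zero]

end Weights

end Enumeration

section PowerSeries

open PowerSeries

/-! ### Evaluation of a power series at a power series -/

section Evaluation

variable {K : Type*} [CommRing K]

theorem PowerSeries.eq_of_forall_X_pow_dvd_sub {a b : K⟦X⟧} (h : ∀ m, X ^ m ∣ a - b) : a = b := by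
  ext k
  have := X_pow_dvd_iff.1 (h (k + 1)) k k.lt_succ_self
  rwa [map_sub, sub_eq_zero] at this

theorem X_pow_dvd_eval_sub {τ : K⟦X⟧} (hτ : X ∣ τ) {m : ℕ} {p q : Polynomial K⟦X⟧}
    (h : ∀ k < m, p.coeff k = q.coeff k) : X ^ m ∣ p.eval τ - q.eval τ := by
  obtain ⟨r, hr⟩ : Polynomial.X ^ m ∣ p - q :=
    Polynomial.X_pow_dvd_iff.2 fun k hk => by rw [Polynomial.coeff_sub, h k hk, sub_self]
  rw [← Polynomial.eval_sub, hr, Polynomial.eval_mul, Polynomial.eval_pow, Polynomial.eval_X]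
  exact (pow_dvd_pow_of_dvd hτ m).mul_right _

/-- The value at `t = τ` of a power series in `t` whose coefficients are power series in `z`. It
makes sense when `z` divides `τ`: the coefficient of `z ^ k` depends on the terms of degree at most
`k` in `t` only. -/
noncomputable def evalSeries (τ : K⟦X⟧) (f : K⟦X⟧⟦X⟧) : K⟦X⟧ :=
  mk fun k => coeff k ((trunc (k + 1) f).eval τ)

theorem X_pow_dvd_evalSeries_sub {τ : K⟦X⟧} (hτ : X ∣ τ) (f : K⟦X⟧⟦X⟧) (m : ℕ) :
    X ^ m ∣ evalSeries τ f - (trunc m f).eval τ := by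
  refine X_pow_dvd_iff.2 fun k hk => ?_
  rw [map_sub, evalSeries, coeff_mk, ← map_sub]
  refine X_pow_dvd_iff.1 (X_pow_dvd_eval_sub hτ (m := k + 1) fun j hj => ?_) k k.lt_succ_self
  rw [coeff_trunc, coeff_trunc, if_pos hj, if_pos (by omega)]

/-- The value of a power series may be computed, modulo each power of `z`, with any polynomial that
agrees with the power series up to that order. -/
theorem evalSeries_eq {τ : K⟦X⟧} (hτ : X ∣ τ) {f : K⟦X⟧⟦X⟧} {a : K⟦X⟧}
    (p : ℕ → Polynomial K⟦X⟧) (hp : ∀ m, ∀ k < m, (p m).coeff k = coeff k f)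
    (ha : ∀ m, X ^ m ∣ (p m).eval τ - a) : evalSeries τ f = a := by
  refine eq_of_forall_X_pow_dvd_sub fun m => ?_
  have h₁ := X_pow_dvd_evalSeries_sub hτ f m
  have h₂ := X_pow_dvd_eval_sub hτ (m := m) (p := trunc m f) (q := p m) fun k hk => by
    rw [coeff_trunc, if_pos hk, hp m k hk]
  convert dvd_add (dvd_add h₁ h₂) (ha m) using 1
  ring

theorem evalSeries_coe {τ : K⟦X⟧} (hτ : X ∣ τ) (p : Polynomial K⟦X⟧) :
    evalSeries τ p = p.eval τ :=
  evalSeries_eq hτ (fun _ => p) (fun _ _ _ => (Polynomial.coeff_coe p _).symm) fun m => by simp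

/-- Evaluation at `t = τ`, as a ring homomorphism. -/
noncomputable def evalHom (τ : K⟦X⟧) (hτ : X ∣ τ) : K⟦X⟧⟦X⟧ →+* K⟦X⟧ where
  toFun := evalSeries τ
  map_zero' := by simpa using evalSeries_coe hτ 0
  map_one' := by simpa using evalSeries_coe hτ 1
  map_add' f g := evalSeries_eq hτ (fun m => trunc m f + trunc m g)
    (fun m k hk => by simp [coeff_trunc, hk]) fun m => by
      have h := dvd_neg.2 (dvd_add (X_pow_dvd_evalSeries_sub hτ f m)
        (X_pow_dvd_evalSeries_sub hτ g m))
      rw [Polynomial.eval_add]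
      convert h using 1
      ring
  map_mul' f g := evalSeries_eq hτ (fun m => trunc m f * trunc m g)
    (fun m k hk => by
      rw [← Polynomial.coeff_coe, Polynomial.coe_mul, ← coeff_mul_eq_coeff_trunc_mul_trunc _ _ hk])
    fun m => by
      have h := dvd_neg.2 (dvd_add
        ((X_pow_dvd_evalSeries_sub hτ f m).mul_right (evalSeries τ g))
        ((X_pow_dvd_evalSeries_sub hτ g m).mul_right ((trunc m f).eval τ)))
      rw [Polynomial.eval_mul]
      convert h using 1
      ring

variable {τ : K⟦X⟧} (hτ : X ∣ τ)

theorem evalHom_C (a : K⟦X⟧) : evalHom τ hτ (C a) = a :=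
  (congrArg (evalSeries τ) (Polynomial.coe_C a).symm).trans ((evalSeries_coe hτ _).trans
    Polynomial.eval_C)

theorem evalHom_X : evalHom τ hτ X = τ :=
  (congrArg (evalSeries τ) Polynomial.coe_X.symm).trans ((evalSeries_coe hτ _).trans
    Polynomial.eval_X)

theorem constantCoeff_evalHom (f : K⟦X⟧⟦X⟧) :
    constantCoeff (evalHom τ hτ f) = constantCoeff (constantCoeff f) := by
  rw [← coeff_zero_eq_constantCoeff_apply, ← coeff_zero_eq_constantCoeff_apply,
    ← coeff_zero_eq_constantCoeff_apply]
  simp [evalHom, evalSeries, trunc_one_left]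

theorem map_evalHom {L : Type*} [CommRing L] (φ : K →+* L) (hφ : X ∣ PowerSeries.map φ τ)
    (f : K⟦X⟧⟦X⟧) : PowerSeries.map φ (evalHom τ hτ f) =
      evalHom (PowerSeries.map φ τ) hφ (PowerSeries.map (PowerSeries.map φ) f) := by
  ext k
  simp only [evalHom, evalSeries, RingHom.coe_mk, MonoidHom.coe_mk, OneHom.coe_mk, coeff_map,
    coeff_mk]
  rw [← coeff_map, trunc_map, Polynomial.eval_map_apply]

/-- On power series with constant coefficients, evaluation is substitution. -/
theorem evalHom_map_C (f : K⟦X⟧) : evalHom τ hτ (PowerSeries.map C f) = f.subst τ := by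
  have hs : HasSubst τ := HasSubst.of_constantCoeff_zero' (X_dvd_iff.1 hτ)
  refine evalSeries_eq hτ (fun m => (trunc m f).map C)
    (fun m k hk => by simp [coeff_trunc, hk]) fun m => ?_
  obtain ⟨g, hg⟩ : X ^ m ∣ (trunc m f : K⟦X⟧) - f := X_pow_dvd_iff.2 fun k hk => by
    simp [coeff_trunc, hk]
  have h := congrArg (subst τ) hg
  rw [subst_sub hs, subst_mul hs, subst_pow hs, subst_X hs, subst_coe hs] at h
  rw [Polynomial.eval_map]
  have h' : Polynomial.eval₂ C τ (trunc m f) = Polynomial.aeval τ (trunc m f) := rfl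
  rw [h', h]
  exact (pow_dvd_pow_of_dvd hτ m).mul_right _

end Evaluation

/-! ### Fixed points -/

/-- The fixed point theorem for maps that are contracting in the `X`-adic sense. -/
theorem PowerSeries.existsUnique_fixedPoint {K : Type*} [CommRing K] (φ : K⟦X⟧ → K⟦X⟧)
    (h : ∀ k a b, X ^ k ∣ a - b → X ^ (k + 1) ∣ φ a - φ b) : ∃! a, φ a = a := by
  have hsucc : ∀ n, X ^ n ∣ φ^[n + 1] 0 - φ^[n] 0 := by
    intro n
    induction n with
    | zero => simp
    | succ n ih =>
      rw [Function.iterate_succ_apply' φ (n + 1), Function.iterate_succ_apply' φ n]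
      exact h n _ _ (by simpa only [Function.iterate_succ_apply'] using ih)
  have hle : ∀ n d, X ^ n ∣ φ^[n + d] 0 - φ^[n] 0 := by
    intro n d
    induction d with
    | zero => simp
    | succ d ih =>
      have := dvd_add ((pow_dvd_pow X (Nat.le_add_right n d)).trans (hsucc (n + d))) ih
      rwa [sub_add_sub_cancel] at this
  set L : K⟦X⟧ := mk fun n => coeff n (φ^[n + 1] 0) with hL
  have hlim : ∀ n, X ^ n ∣ L - φ^[n] 0 := by
    refine fun n => X_pow_dvd_iff.2 fun k hk => ?_
    obtain ⟨d, rfl⟩ := Nat.exists_eq_add_of_lt hk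
    have := X_pow_dvd_iff.1 (hle (k + 1) d) k k.lt_succ_self
    rw [map_sub, sub_eq_zero] at this
    rw [map_sub, hL, coeff_mk, ← this, sub_eq_zero, add_right_comm]
  have hLφ : φ L = L := eq_of_forall_X_pow_dvd_sub fun n => by
    have h₁ := h n _ _ (hlim n)
    rw [← Function.iterate_succ_apply' φ n] at h₁
    have h₂ := dvd_sub h₁ (hlim (n + 1))
    rw [sub_sub_sub_cancel_right] at h₂
    exact (pow_dvd_pow X n.le_succ).trans h₂
  refine ⟨L, hLφ, fun b hb => eq_of_forall_X_pow_dvd_sub fun n => ?_⟩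
  induction n with
  | zero => simp
  | succ n ih =>
    have := h n _ _ ih
    rwa [hLφ, show φ b = b from hb] at this

end PowerSeries

/-! ### The parametrization -/

section Parametrization

open PowerSeries

/-- A solution of the functional equation for Tamari intervals, parametrized by `z` and `u`, where
`v` is the inverse of `1 + z u` and `n` the inverse of `1 - z`: the catalytic variable is
`x = (1 + u) v²`, the size variable is `z (1 - z)³`, and the solution specializes to
`(1 - 2 z) n³` at `x = 1`. -/
theorem functionalEquation_parametrization {A : Type*} [CommRing A] {z u v n : A}
    (hv : (1 + z * u) * v = 1) (hn : (1 - z) * n = 1) :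
    ((1 + u) * v ^ 2 - 1) * ((1 + u) * (1 - 2 * z - z ^ 2 * u) * v * n ^ 3) =
      ((1 + u) * v ^ 2 - 1) * ((1 + u) * v ^ 2) +
        z * (1 - z) ^ 3 * ((1 + u) * v ^ 2 *
          ((1 + u) * (1 - 2 * z - z ^ 2 * u) * v * n ^ 3 - (1 - 2 * z) * n ^ 3) *
          ((1 + u) * (1 - 2 * z - z ^ 2 * u) * v * n ^ 3)) := by
  have e₁ : (1 + u) * v ^ 2 - 1 = u * (1 - 2 * z - z ^ 2 * u) * v ^ 2 := by
    linear_combination ((1 + z * u) * v + 1) * hv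
  have e₂ : (1 + u) * (1 - 2 * z - z ^ 2 * u) * v * n ^ 3 - (1 - 2 * z) * n ^ 3 =
      n ^ 3 * v * u * (1 - 3 * z + z ^ 2 - z ^ 2 * u) := by
    linear_combination n ^ 3 * (1 - 2 * z) * hv
  have e₃ : (1 - z) ^ 3 * n ^ 3 = 1 := by rw [← mul_pow, hn, one_pow]
  rw [e₁, e₂]
  linear_combination ((1 + u) * v ^ 2 * u * (1 - 2 * z - z ^ 2 * u)) *
    (-(z * v ^ 2 * (1 - 3 * z + z ^ 2 - z ^ 2 * u) * (1 + u) * n ^ 3) * e₃ + v ^ 2 * e₃ -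
      n ^ 3 * (1 - 2 * z - z ^ 2 * u) * v * hv)

theorem exists_mul_eq_one_of_constantCoeff {K : Type*} [CommRing K] {a : K⟦X⟧}
    (h : constantCoeff a = 1) : ∃ b, a * b = 1 :=
  (isUnit_iff_constantCoeff.2 (h ▸ isUnit_one)).exists_right_inv

theorem X_dvd_X_mul_one_sub_X_pow {K : Type*} [CommRing K] : (X : K⟦X⟧) ∣ X * (1 - X) ^ 3 :=
  dvd_mul_right _ _

/-- Evaluation at the size variable `t = z (1 - z)³`. -/
noncomputable abbrev evalSize {K : Type*} [CommRing K] : K⟦X⟧⟦X⟧ →+* K⟦X⟧ :=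
  evalHom (X * (1 - X) ^ 3) X_dvd_X_mul_one_sub_X_pow

variable {K : Type*} [CommRing K]

theorem evalSize_tamariSeries (x : K⟦X⟧) :
    (x - 1) * evalSize (tamariSeries x) = (x - 1) * x + X * (1 - X) ^ 3 *
      (x * (evalSize (tamariSeries x) - evalSize (tamariSeries 1)) *
        evalSize (tamariSeries x)) := by
  have h := congrArg evalSize (tamariSeries_functionalEquation x)
  simpa only [map_mul, map_add, map_sub, evalHom_C, evalHom_X, map_one] using h

theorem evalSize_tamariUpperSeries (x s : K⟦X⟧) :
    (x - 1) * evalSize (tamariUpperSeries x s) = (x - 1) * x + X * (1 - X) ^ 3 *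
      (x * ((evalSize (tamariSeries x) - evalSize (tamariSeries 1)) +
        s * (evalSize (tamariUpperSeries x s) - evalSize (tamariUpperSeries 1 s))) *
          evalSize (tamariSeries x) +
        x * (evalSize (tamariSeries x) - evalSize (tamariSeries 1)) *
          evalSize (tamariUpperSeries x s)) := by
  have h := congrArg evalSize (tamariUpperSeries_functionalEquation x s)
  simpa only [map_mul, map_add, map_sub, evalHom_C, evalHom_X, map_one] using h

theorem constantCoeff_evalSize_tamariSeries (x : K⟦X⟧) :
    constantCoeff (evalSize (tamariSeries x)) = constantCoeff x := by
  rw [constantCoeff_evalHom, constantCoeff_tamariSeries]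

theorem X_pow_dvd_of_C_mul {p : Polynomial ℚ} (hp : p ≠ 0) {k : ℕ} {D : (Polynomial ℚ)⟦X⟧}
    (h : X ^ k ∣ C p * D) : X ^ k ∣ D := by
  rw [X_pow_dvd_iff] at h ⊢
  intro m hm
  have := h m hm
  rw [coeff_C_mul] at this
  exact (mul_eq_zero.1 this).resolve_left hp

/-- The generating function of Tamari intervals. Here the indeterminate `s` of the coefficient ring
serves as the parameter `u` of the catalytic variable `x = (1 + u) / (1 + z u)²`. Setting `u = 0`
gives `x = 1`, and `x - 1` is `u` times a unit, so that the functional equation has at most one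
solution: the difference of two solutions is divisible by every power of `z`. -/
theorem evalSize_tamariSeries_one {n : (Polynomial ℚ)⟦X⟧} (hn : (1 - X) * n = 1) :
    evalSize (tamariSeries (1 : (Polynomial ℚ)⟦X⟧)) = (1 - 2 * X) * n ^ 3 := by
  set u : (Polynomial ℚ)⟦X⟧ := C Polynomial.X with hu
  obtain ⟨v, hv⟩ := exists_mul_eq_one_of_constantCoeff (a := 1 + X * u) (by simp)
  set x := (1 + u) * v ^ 2 with hx
  set Φ := evalSize (tamariSeries x)
  set F := evalSize (tamariSeries (1 : (Polynomial ℚ)⟦X⟧))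
  set Ψ := (1 + u) * (1 - 2 * X - X ^ 2 * u) * v * n ^ 3 with hΨ
  set G := (1 - 2 * X) * n ^ 3 with hG
  have hΦ_eq := evalSize_tamariSeries x
  have hΨ_eq := functionalEquation_parametrization hv hn
  -- the substitution `u = 0`
  set ε : Polynomial ℚ →+* Polynomial ℚ := Polynomial.C.comp (Polynomial.evalRingHom 0) with hε
  have hεX : PowerSeries.map ε X = X := map_X ε
  have hεu : PowerSeries.map ε u = 0 := by simp [hu, hε]
  have hεv : PowerSeries.map ε v = 1 := by
    have := congrArg (PowerSeries.map ε) hv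
    simpa [hεu] using this
  have hεn : PowerSeries.map ε n = n := by
    have h := congrArg (PowerSeries.map ε) hn
    rw [map_mul, map_sub, map_one, hεX] at h
    linear_combination n * h - PowerSeries.map ε n * hn
  have hεx : PowerSeries.map ε x = 1 := by simp [hx, hεu, hεv]
  have hετ : PowerSeries.map ε (X * (1 - X) ^ 3) = X * (1 - X) ^ 3 := by simp
  have hεΦ : PowerSeries.map ε Φ = F := by
    have h := map_evalHom X_dvd_X_mul_one_sub_X_pow ε
      (by rw [hετ]; exact X_dvd_X_mul_one_sub_X_pow)
      (tamariSeries x)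
    rw [map_tamariSeries, hεx] at h
    simp only [hετ] at h
    exact h
  have hεΨ : PowerSeries.map ε Ψ = G := by
    have hε₂ : PowerSeries.map ε 2 = 2 := map_ofNat _ 2
    simp [hΨ, hG, hεu, hεv, hεn, hε₂]
  have hx₁ : x - 1 = u * ((1 - 2 * X - X ^ 2 * u) * v ^ 2) := by
    rw [hx]
    linear_combination ((1 + X * u) * v + 1) * hv
  obtain ⟨w, hw⟩ := exists_mul_eq_one_of_constantCoeff (a := 1 - 2 * X - X ^ 2 * u) (by simp)
  have key : u * (Φ - Ψ) = X * ((1 - X) ^ 3 * x * (1 + X * u) ^ 2 * w *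
      ((Φ + Ψ - F) * (Φ - Ψ) - Ψ * (F - G))) := by
    have h : (x - 1) * (Φ - Ψ) = X * (1 - X) ^ 3 * x *
        ((Φ + Ψ - F) * (Φ - Ψ) - Ψ * (F - G)) := by
      linear_combination hΦ_eq - hΨ_eq
    rw [hx₁] at h
    linear_combination (1 + X * u) ^ 2 * w * h -
      u * (Φ - Ψ) * ((1 + X * u) ^ 2 * v ^ 2 * hw + ((1 + X * u) * v + 1) * hv)
  have hdvd : ∀ k, X ^ k ∣ Φ - Ψ := by
    intro k
    induction k with
    | zero => simp
    | succ k ih =>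
      have hF : X ^ k ∣ F - G := by
        have := _root_.map_dvd (PowerSeries.map ε) ih
        rwa [map_pow, hεX, map_sub, hεΦ, hεΨ] at this
      refine X_pow_dvd_of_C_mul Polynomial.X_ne_zero (D := Φ - Ψ) ?_
      rw [← hu, key, pow_succ']
      exact mul_dvd_mul_left _ ((dvd_sub (ih.mul_left _) (hF.mul_left _)).mul_left _)
  have h := congrArg (PowerSeries.map ε) (eq_of_forall_X_pow_dvd_sub hdvd)
  rwa [hεΦ, hεΨ] at h

/-- The relation `t = z (1 - z)³` defines a power series `z` in `t`: the constant coefficient of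
`z` is `0` or `1`, the second value is excluded by the order of `(1 - z)³`, and `z = t w` turns the
relation into a fixed point equation for `w`. -/
theorem existsUnique_mul_one_sub_pow_eq_X {k : Type*} [Field k] :
    ∃! Z : k⟦X⟧, Z * (1 - Z) ^ 3 = X := by
  obtain ⟨W, hW, huniq⟩ := existsUnique_fixedPoint
    (fun W : k⟦X⟧ => 1 + W * (1 - (1 - X * W) ^ 3)) fun k a b h => by
      have e : (1 + a * (1 - (1 - X * a) ^ 3)) - (1 + b * (1 - (1 - X * b) ^ 3)) =
          X * ((a - b) * (3 * (a + b) - 3 * X * (a ^ 2 + a * b + b ^ 2) +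
            X ^ 2 * (a ^ 3 + a ^ 2 * b + a * b ^ 2 + b ^ 3))) := by
        ring
      rw [e, pow_succ']
      exact mul_dvd_mul_left _ (h.mul_right _)
  have hX : (X : k⟦X⟧) ≠ 0 := X_ne_zero
  refine ⟨X * W, ?_, fun Z hZ => ?_⟩
  · linear_combination -X * hW
  · have h₀ := congrArg constantCoeff hZ
    simp only [map_mul, map_pow, map_sub, map_one, constantCoeff_X, mul_eq_zero,
      pow_eq_zero_iff three_ne_zero] at h₀
    rcases h₀ with h₀ | h₀
    · obtain ⟨Y, rfl⟩ := X_dvd_iff.2 h₀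
      rw [huniq Y]
      have := mul_left_cancel₀ hX (a := X) (b := Y * (1 - X * Y) ^ 3) (c := 1)
        (by linear_combination hZ)
      linear_combination -this
    · obtain ⟨Y, hY⟩ := X_dvd_iff.2 (show constantCoeff (1 - Z) = 0 by simpa using h₀)
      exfalso
      replace hZ : Z * (1 - Z) ^ 3 = X := hZ
      rw [hY] at hZ
      have := mul_left_cancel₀ hX (a := X) (b := Z * X ^ 2 * Y ^ 3) (c := 1)
        (by linear_combination hZ)
      simpa using congrArg constantCoeff this

theorem existsUnique_isUpperParameter : ∃! U, IsUpperParameter U := by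
  obtain ⟨n, hn⟩ := exists_mul_eq_one_of_constantCoeff (a := (1 - X : (Polynomial ℚ)⟦X⟧)) (by simp)
  have hn₃ : (1 - X) ^ 3 * n ^ 3 = 1 := by rw [← mul_pow, hn, one_pow]
  have hiff : ∀ U, IsUpperParameter U ↔
      X * (C Polynomial.X * (1 + U) ^ 2 * (1 - U * X ^ 2 - 2 * X) * n ^ 3) = U := fun U =>
    ⟨fun h => by
      rw [IsUpperParameter] at h
      linear_combination n ^ 3 * h + U * hn₃, fun h => by
      rw [IsUpperParameter]
      linear_combination (1 - X) ^ 3 * h -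
        C Polynomial.X * X * (1 + U) ^ 2 * (1 - U * X ^ 2 - 2 * X) * hn₃⟩
  simp only [hiff]
  refine existsUnique_fixedPoint _ fun k a b h => ?_
  have e : X * (C Polynomial.X * (1 + a) ^ 2 * (1 - a * X ^ 2 - 2 * X) * n ^ 3) -
      X * (C Polynomial.X * (1 + b) ^ 2 * (1 - b * X ^ 2 - 2 * X) * n ^ 3) =
      X * ((a - b) * (C Polynomial.X * n ^ 3 *
        ((2 + a + b) * (1 - a * X ^ 2 - 2 * X) - X ^ 2 * (1 + b) ^ 2))) := by
    ring
  rw [e, pow_succ']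
  exact mul_dvd_mul_left _ (h.mul_right _)

theorem IsUpperParameter.constantCoeff_eq_zero {U : (Polynomial ℚ)⟦X⟧} (hU : IsUpperParameter U) :
    constantCoeff U = 0 := by
  have h := congrArg constantCoeff hU
  simpa using h.symm

/-- The kernel method. At `x = (1 + U) / (1 + z U)²` the coefficient of `H(x)` in the linear
functional equation vanishes, and what remains determines `H(1)`. -/
theorem IsUpperParameter.subst_tamariUpperSeries {U : (Polynomial ℚ)⟦X⟧}
    (hU : IsUpperParameter U) :
    subst (X * (1 - X) ^ 3 : (Polynomial ℚ)⟦X⟧)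
        (tamariUpperSeries (1 : Polynomial ℚ) Polynomial.X) * (1 - X) ^ 6 =
      (1 - 2 * X - U * X ^ 2) ^ 2 * (1 + U) := by
  have hU₀ := hU.constantCoeff_eq_zero
  rw [IsUpperParameter] at hU
  set s : (Polynomial ℚ)⟦X⟧ := C Polynomial.X with hs
  obtain ⟨n, hn⟩ := exists_mul_eq_one_of_constantCoeff (a := (1 - X : (Polynomial ℚ)⟦X⟧)) (by simp)
  obtain ⟨v, hv⟩ := exists_mul_eq_one_of_constantCoeff (a := 1 + X * U) (by simp)
  have hn₃ : (1 - X) ^ 3 * n ^ 3 = 1 := by rw [← mul_pow, hn, one_pow]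
  have hn₀ : constantCoeff n = 1 := by simpa using congrArg constantCoeff hn
  have hv₀ : constantCoeff v = 1 := by simpa using congrArg constantCoeff hv
  -- `U = s z + O(z²)`
  obtain ⟨V, hV⟩ := X_dvd_iff.2 hU₀
  have hV₀ : constantCoeff V = Polynomial.X := by
    have h : s * ((1 + U) ^ 2 * (1 - U * X ^ 2 - 2 * X)) = V * (1 - X) ^ 3 :=
      mul_left_cancel₀ X_ne_zero (by linear_combination hU + (1 - X) ^ 3 * hV)
    simpa [hU₀, hs] using (congrArg constantCoeff h).symm
  have hU_ne : U ≠ 0 := by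
    rintro rfl
    have : V = 0 := (mul_eq_zero.1 hV.symm).resolve_left X_ne_zero
    rw [this, map_zero] at hV₀
    exact Polynomial.X_ne_zero hV₀.symm
  set x := (1 + U) * v ^ 2 with hx
  have hx₀ : constantCoeff x = 1 := by simp [hx, hU₀, hv₀]
  have hx₁ : x - 1 = U * (1 - 2 * X - X ^ 2 * U) * v ^ 2 := by
    rw [hx]
    linear_combination ((1 + X * U) * v + 1) * hv
  have hx₁_ne : x - 1 ≠ 0 := by
    have h₁ : v ≠ 0 := by rintro rfl; simp at hv₀
    have h₂ : (1 - 2 * X - X ^ 2 * U : (Polynomial ℚ)⟦X⟧) ≠ 0 := fun h => by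
      simpa using congrArg constantCoeff h
    rw [hx₁]
    exact mul_ne_zero (mul_ne_zero hU_ne h₂) (pow_ne_zero 2 h₁)
  have hF := evalSize_tamariSeries x
  have hH := evalSize_tamariUpperSeries x s
  have hΦ₀ := constantCoeff_evalSize_tamariSeries x
  have hΨ_eq := functionalEquation_parametrization hv hn
  rw [evalSize_tamariSeries_one hn] at hF hH
  rw [hx₀] at hΦ₀
  have hH₁ : evalSize (tamariUpperSeries 1 s) = subst (X * (1 - X) ^ 3 : (Polynomial ℚ)⟦X⟧)
      (tamariUpperSeries (1 : Polynomial ℚ) Polynomial.X) := by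
    rw [← evalHom_map_C X_dvd_X_mul_one_sub_X_pow, map_tamariUpperSeries, map_one]
  rw [← hH₁]
  set Φ := evalSize (tamariSeries x)
  set H := evalSize (tamariUpperSeries x s)
  set H₁ := evalSize (tamariUpperSeries 1 s)
  rw [← hx] at hΨ_eq
  set Ψ := (1 + U) * (1 - 2 * X - X ^ 2 * U) * v * n ^ 3 with hΨ
  have hΨ₀ : constantCoeff Ψ = 1 := by simp [hΨ, hU₀, hv₀, hn₀]
  -- `Φ` and `Ψ` are roots of the same quadratic polynomial. They are not its two distinct roots:
  -- Vieta's relation for the sum fails for them, with a discrepancy of `(s - 1) z + O(z²)`.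
  have hΦΨ : Φ = Ψ := by
    have h : X * ((Φ - Ψ) * (V * (1 - 2 * X - X ^ 2 * U) * v ^ 2 -
        (1 - X) ^ 3 * x * (Φ + Ψ - (1 - 2 * X) * n ^ 3))) = 0 := by
      linear_combination hF - hΨ_eq - (Φ - Ψ) * hx₁ -
        (Φ - Ψ) * (1 - 2 * X - X ^ 2 * U) * v ^ 2 * hV
    rcases mul_eq_zero.1 ((mul_eq_zero.1 h).resolve_left X_ne_zero) with h | h
    · exact sub_eq_zero.1 h
    · have h := congrArg constantCoeff h
      simp only [map_sub, map_mul, map_add, map_pow, map_one, map_zero, constantCoeff_X, hV₀, hv₀,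
        hx₀, hΦ₀, hΨ₀, hn₀, map_ofNat] at h
      have h := congrArg (Polynomial.eval 0) h
      norm_num at h
  rw [hΦΨ] at hH
  have hker : x - 1 = X * (1 - X) ^ 3 * s * Ψ ^ 2 := by
    rw [hx₁, hΨ]
    linear_combination (-((1 - X) ^ 3 * (1 - 2 * X - X ^ 2 * U) * v ^ 2 * n ^ 6)) * hU -
      U * (1 - 2 * X - X ^ 2 * U) * v ^ 2 * ((1 - X) ^ 3 * n ^ 3 + 1) * hn₃
  have hH₁x : x * H₁ = Ψ ^ 2 := by
    refine mul_left_cancel₀ hx₁_ne ?_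
    linear_combination Ψ * hH - (Ψ + H) * hΨ_eq - x * (H - H₁) * hker
  have hU₁ : (1 + U : (Polynomial ℚ)⟦X⟧) ≠ 0 := fun h => by
    have h := congrArg constantCoeff h
    rw [map_add, map_one, hU₀, map_zero, add_zero] at h
    exact one_ne_zero h
  refine mul_left_cancel₀ hU₁ ?_
  rw [hx, hΨ] at hH₁x
  linear_combination (1 + X * U) ^ 2 * (1 - X) ^ 6 * hH₁x -
    (1 + U) * H₁ * (1 - X) ^ 6 * ((1 + X * U) * v + 1) * hv +
    (1 + U) ^ 2 * (1 - 2 * X - X ^ 2 * U) ^ 2 * (n ^ 6 * (1 - X) ^ 6 * ((1 + X * U) * v + 1) * hv +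
      ((1 - X) ^ 3 * n ^ 3 + 1) * hn₃)

end Parametrization

theorem mainTheorem6 :
    -- `t = z (1 - z)³` defines `z` as a power series in `t`
    (∃! Z : PowerSeries ℚ, Z * (1 - Z) ^ 3 = PowerSeries.X) ∧
    -- the relation between `s`, `z`, `U` defines `U` as a power series in `z` over `ℚ[s]`
    (∃! U : PowerSeries (Polynomial ℚ), IsUpperParameter U) ∧
    -- the parametrization of `H(t, 1, s)` at `t = z (1 - z)³`
    ∀ U : PowerSeries (Polynomial ℚ), IsUpperParameter U →
      PowerSeries.constantCoeff U = 0 ∧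
      PowerSeries.subst
          (PowerSeries.X * (1 - PowerSeries.X) ^ 3 : PowerSeries (Polynomial ℚ))
          (tamariUpperSeries (1 : Polynomial ℚ) Polynomial.X) *
          (1 - PowerSeries.X) ^ 6 =
        (1 - 2 * PowerSeries.X - U * PowerSeries.X ^ 2) ^ 2 * (1 + U) :=
  ⟨existsUnique_mul_one_sub_pow_eq_X, existsUnique_isUpperParameter,
    fun _ hU => ⟨hU.constantCoeff_eq_zero, hU.subst_tamariUpperSeries⟩⟩
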